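/- Conventions. An mm-space is a complete separable metric space $X$ with a Borel probability measure $\mu_X$. For $N\ge 1$ and $\kappa_0,\dots,\kappa_N>0$, the separation distance $\mathrm{Sep}(X;\kappa_0,\dots,\kappa_N)$ is the supremum of $\min_{i\ne k} d_X(A_i,A_k)$ over all Borel sets $A_0,\dots,A_N\subset X$ with $\mu_X(A_i)\ge\kappa_i$ for all $i$, where $d_X(A,B)=\inf_{x\in A,\,y\in B}d_X(x,y)$; it is $0$ if there are no such sets. A sequence $\{X_j\}$ of mm-spaces infinitely dissipates if for every $\delta>0$, every $N\ge1$ and all $\kappa_0,\dots,\kappa_N>0$ with $\sum_i\kappa_i<1$ we have $\liminf_{j\to\infty}\mathrm{Sep}(X_j;\kappa_0,\dots,\kappa_N)\ge\delta$. For $n\ge2$ and $\alpha_1,\dots,\alpha_n>0$, let $E^n_{\{\alpha_i\}}$ be any one of the following two mm-spaces, with the restriction of the Euclidean distance of $\mathbb R^n$: the solid ellipsoid $\{x\in\mathbb R^n : \sum_{i=1}^n x_i^2/\alpha_i^2\le 1\}$ with the normalized Lebesgue measure, or the ellipsoid $\{x\in\mathbb R^n : \sum_{i=1}^n x_i^2/\alpha_i^2=1\}$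 with the push-forward of the normalized volume measure of the unit sphere $S^{n-1}(1)$ under $(x_1,\dots,x_n)\mapsto(\alpha_1x_1,\dots,\alpha_nx_n)$. Proposition. Let $n(j)\ge 2$ be integers and $a_{ij}$, $i=1,\dots,n(j)$, $j=1,2,\dots$, positive real numbers. If $\sup_i a_{ij}\to\infty$ as $j\to\infty$, then the sequence $\{E^{n(j)}_{\{\sqrt{n(j)-1}\,a_{ij}\}_i}\}_j$ infinitely dissipates. (For each $j$, either of the two kinds may be taken.) -/

import Mathlib

open MeasureTheory Filter Topology
open scoped ENNReal

universe u

noncomputable section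

/-- An mm-space: a complete separable metric space with a Borel probability measure. -/
structure MMSpace where
  carrier : Type u
  [metricSpace : MetricSpace carrier]
  [completeSpace : CompleteSpace carrier]
  [separableSpace : TopologicalSpace.SeparableSpace carrier]
  [measurableSpace : MeasurableSpace carrier]
  [borelSpace : BorelSpace carrier]
  measure : Measure carrier
  [isProbabilityMeasure : IsProbabilityMeasure measure]

namespace MMSpace

attribute [instance] metricSpace completeSpace separableSpace measurableSpace borelSpace
  isProbabilityMeasure

/-- The distance `inf_{x ∈ A, y ∈ B} d(x, y)` between two subsets (`∞` if one of them is empty). -/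
def setDist (X : MMSpace.{u}) (A B : Set X.carrier) : ℝ≥0∞ :=
  ⨅ x ∈ A, ⨅ y ∈ B, edist x y

/-- The separation distance `Sep(X; κ_0, …, κ_N)`: the supremum of `min_{i ≠ j} d(A_i, A_j)` over
all families of Borel sets `A_0, …, A_N` with `μ(A_i) ≥ κ_i` for all `i`; it is `0` if there is no
such family. It is only used for `N ≥ 1` and positive `κ_i`. -/
def sep (X : MMSpace.{u}) {N : ℕ} (κ : Fin (N + 1) → ℝ) : ℝ≥0∞ :=
  ⨆ (A : Fin (N + 1) → Set X.carrier)
    (_ : ∀ i, MeasurableSet (A i) ∧ ENNReal.ofReal (κ i) ≤ X.measure (A i)),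
      ⨅ (i : Fin (N + 1)) (k : Fin (N + 1)) (_ : i ≠ k), X.setDist (A i) (A k)

/-- A sequence of mm-spaces `δ`-dissipates if `liminf_j Sep(X_j; κ_0, …, κ_N) ≥ δ` for all `N ≥ 1`
and all positive reals `κ_0, …, κ_N` with `κ_0 + ⋯ + κ_N < 1`. -/
def Dissipates (X : ℕ → MMSpace.{u}) (δ : ℝ) : Prop :=
  ∀ (N : ℕ), 1 ≤ N → ∀ κ : Fin (N + 1) → ℝ, (∀ i, 0 < κ i) → ∑ i, κ i < 1 →
    ENNReal.ofReal δ ≤ liminf (fun j => (X j).sep κ) atTop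

/-- A sequence of mm-spaces infinitely dissipates if it `δ`-dissipates for every `δ > 0`. -/
def InfinitelyDissipates (X : ℕ → MMSpace.{u}) : Prop :=
  ∀ δ : ℝ, 0 < δ → Dissipates X δ

end MMSpace

/-- The linear map `L_α(x) = (α_1 x_1, …, α_n x_n)` of Euclidean space. -/
def axisScale {n : ℕ} (α : Fin n → ℝ) (x : EuclideanSpace ℝ (Fin n)) :
    EuclideanSpace ℝ (Fin n) :=
  WithLp.toLp 2 fun i => α i * x i

/-- The solid ellipsoid with semi-axes `α_i`, as a set. -/
def solidEllipsoidSet {n : ℕ} (α : Fin n → ℝ) : Set (EuclideanSpace ℝ (Fin n)) :=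
  {x | ∑ i, x i ^ 2 / α i ^ 2 ≤ 1}

/-- The ellipsoid (hypersurface) with semi-axes `α_i`, as a set. -/
def ellipsoidSet {n : ℕ} (α : Fin n → ℝ) : Set (EuclideanSpace ℝ (Fin n)) :=
  {x | ∑ i, x i ^ 2 / α i ^ 2 = 1}

theorem continuous_ellipsoidForm {n : ℕ} (α : Fin n → ℝ) :
    Continuous fun x : EuclideanSpace ℝ (Fin n) => ∑ i, x i ^ 2 / α i ^ 2 := by
  fun_prop

theorem isClosed_solidEllipsoidSet {n : ℕ} (α : Fin n → ℝ) : IsClosed (solidEllipsoidSet α) :=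
  isClosed_le (continuous_ellipsoidForm α) continuous_const

theorem isClosed_ellipsoidSet {n : ℕ} (α : Fin n → ℝ) : IsClosed (ellipsoidSet α) :=
  isClosed_eq (continuous_ellipsoidForm α) continuous_const

theorem continuous_axisScale {n : ℕ} (α : Fin n → ℝ) : Continuous (axisScale α) := by
  unfold axisScale
  fun_prop

theorem axisScale_mem_ellipsoidSet {n : ℕ} {α : Fin n → ℝ} (hα : ∀ i, 0 < α i)
    {x : EuclideanSpace ℝ (Fin n)} (hx : x ∈ Metric.sphere (0 : EuclideanSpace ℝ (Fin n)) 1) :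
    axisScale α x ∈ ellipsoidSet α := by
  have h1 : ‖x‖ ^ 2 = 1 := by rw [mem_sphere_zero_iff_norm.1 hx]; norm_num
  rw [EuclideanSpace.real_norm_sq_eq] at h1
  change ∑ i, (α i * x i) ^ 2 / α i ^ 2 = 1
  rw [← h1]
  refine Finset.sum_congr rfl fun i _ => ?_
  have := (hα i).ne'
  field_simp

theorem volume_solidEllipsoidSet_ne_zero {n : ℕ} (α : Fin n → ℝ) :
    volume (solidEllipsoidSet α) ≠ 0 := by
  have ho : IsOpen {x : EuclideanSpace ℝ (Fin n) | ∑ i, x i ^ 2 / α i ^ 2 < 1} :=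
    isOpen_lt (continuous_ellipsoidForm α) continuous_const
  have hp := ho.measure_pos volume ⟨0, by simp⟩
  have hs : {x : EuclideanSpace ℝ (Fin n) | ∑ i, x i ^ 2 / α i ^ 2 < 1} ⊆ solidEllipsoidSet α := by
    intro x hx
    exact le_of_lt (Set.mem_ofPred_eq ▸ hx)
  exact (hp.trans_le (measure_mono hs)).ne'

theorem volume_solidEllipsoidSet_ne_top {n : ℕ} {α : Fin n → ℝ} (hα : ∀ i, 0 < α i) :
    volume (solidEllipsoidSet α) ≠ ∞ := by
  refine ((Metric.isBounded_closedBall (x := (0 : EuclideanSpace ℝ (Fin n)))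
    (r := √(∑ i, α i ^ 2))).subset fun x hx => ?_).measure_lt_top.ne
  rw [mem_closedBall_zero_iff, EuclideanSpace.norm_eq]
  refine Real.sqrt_le_sqrt (Finset.sum_le_sum fun i _ => ?_)
  have h1 : x i ^ 2 / α i ^ 2 ≤ 1 :=
    (Finset.single_le_sum (f := fun i => x i ^ 2 / α i ^ 2) (fun k _ => by positivity)
      (Finset.mem_univ i)).trans hx
  rw [div_le_one (pow_pos (hα i) 2)] at h1
  simpa using h1

/-- Normalized Lebesgue measure on the solid ellipsoid. -/
def solidEllipsoidMeasure {n : ℕ} (α : Fin n → ℝ) : Measure (solidEllipsoidSet α) :=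
  (volume (solidEllipsoidSet α))⁻¹ • Measure.comap Subtype.val volume

/-- The normalized volume measure on the unit sphere of `ℝ^n`. -/
def unitSphereMeasure (n : ℕ) : Measure (Metric.sphere (0 : EuclideanSpace ℝ (Fin n)) 1) :=
  ((volume : Measure (EuclideanSpace ℝ (Fin n))).toSphere Set.univ)⁻¹ •
    (volume : Measure (EuclideanSpace ℝ (Fin n))).toSphere

/-- The measure of the ellipsoid: the push-forward of the normalized volume measure of the unit
sphere by the linear map `L_α`. -/
def ellipsoidMeasure {n : ℕ} {α : Fin n → ℝ} (hα : ∀ i, 0 < α i) : Measure (ellipsoidSet α) :=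
  Measure.map (fun x => ⟨axisScale α x.1, axisScale_mem_ellipsoidSet hα x.2⟩) (unitSphereMeasure n)

theorem isProbabilityMeasure_solidEllipsoidMeasure {n : ℕ} {α : Fin n → ℝ} (hα : ∀ i, 0 < α i) :
    IsProbabilityMeasure (solidEllipsoidMeasure α) := by
  constructor
  rw [solidEllipsoidMeasure, Measure.smul_apply, comap_subtype_coe_apply
    (isClosed_solidEllipsoidSet α).measurableSet, smul_eq_mul, Set.image_univ, Subtype.range_coe]
  exact ENNReal.inv_mul_cancel (volume_solidEllipsoidSet_ne_zero α)
    (volume_solidEllipsoidSet_ne_top hα)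

theorem isProbabilityMeasure_unitSphereMeasure {n : ℕ} (hn : 2 ≤ n) :
    IsProbabilityMeasure (unitSphereMeasure n) := by
  have : Nonempty (Fin n) := ⟨⟨0, by omega⟩⟩
  constructor
  rw [unitSphereMeasure, Measure.smul_apply, smul_eq_mul]
  refine ENNReal.inv_mul_cancel ?_ (measure_ne_top _ _)
  rw [Ne, Measure.measure_univ_eq_zero]
  exact Measure.toSphere_ne_zero _

theorem isProbabilityMeasure_ellipsoidMeasure {n : ℕ} (hn : 2 ≤ n) {α : Fin n → ℝ}
    (hα : ∀ i, 0 < α i) : IsProbabilityMeasure (ellipsoidMeasure hα) := by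
  have := isProbabilityMeasure_unitSphereMeasure hn
  refine Measure.isProbabilityMeasure_map (Continuous.measurable ?_).aemeasurable
  exact ((continuous_axisScale α).comp continuous_subtype_val).subtype_mk _

/-- The two kinds of ellipsoids: the solid one and the hypersurface. -/
inductive EllipsoidKind
  | solid
  | surface

/-- The mm-space `E^n_α`: the solid ellipsoid or the ellipsoid with semi-axes `α_1, …, α_n > 0`,
`n ≥ 2`, with the restriction of the Euclidean distance and with the measure above. -/
def ellipsoid (kind : EllipsoidKind) {n : ℕ} (hn : 2 ≤ n) {α : Fin n → ℝ} (hα : ∀ i, 0 < α i) :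
    MMSpace.{0} :=
  match kind with
  | .solid =>
    { carrier := solidEllipsoidSet α
      completeSpace := (isClosed_solidEllipsoidSet α).completeSpace_coe
      measure := solidEllipsoidMeasure α
      isProbabilityMeasure := isProbabilityMeasure_solidEllipsoidMeasure hα }
  | .surface =>
    { carrier := ellipsoidSet α
      completeSpace := (isClosed_ellipsoidSet α).completeSpace_coe
      measure := ellipsoidMeasure hα
      isProbabilityMeasure := isProbabilityMeasure_ellipsoidMeasure hn hα }

theorem sqrt_mul_pos {n : ℕ} (hn : 2 ≤ n) {a : Fin n → ℝ} (ha : ∀ i, 0 < a i) (i : Fin n) :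
    0 < √((n : ℝ) - 1) * a i := by
  have h : (2 : ℝ) ≤ n := by exact_mod_cast hn
  exact mul_pos (Real.sqrt_pos.2 (by linarith)) (ha i)

end

/-! The coordinate along a longest axis is a 1-Lipschitz function whose law spreads out. If every
interval of length `δ` has mass at most `w`, quantiles cut the line into `N + 1` pieces of the
prescribed masses with gaps `δ`, at a cost of `N * w` in mass (`exists_separated_family`), and their
preimages are `δ`-separated (`MMSpace.ofReal_le_sep`). It remains to make `w` small independently of
the dimension.

Put m = n - 1. Undoing the scaling by √m a_i, an interval of length δ becomes one of length δ / (√m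
a_i) for a coordinate on the unit ball or sphere. On the ball an interval of length l has mass at
most l √m, because V_m ≤ √m V_{m+1} (`volume_unitBall_le`). On the sphere the density may be
unbounded (for the circle it blows up at the poles), so bands are replaced by cones in the ball
(`volume_band_le`). Points with a large coordinate and a thin cylinder have relative volume at most
3 / L². On the rest, the coordinate of the direction is u / √(u² + r²) with |u| ≤ L⁴ r, which has a
Lipschitz inverse. Fixing L before the width makes the total small. -/

open scoped Pointwise

/-! ### Quantiles, and separation from an anti-concentrated Lipschitz function -/

open ProbabilityTheory in
/-- Existence of `c`-quantiles of a probability measure on the line. -/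
theorem exists_quantile (m : Measure ℝ) [IsProbabilityMeasure m] {c : ℝ} (h0 : 0 < c)
    (h1 : c < 1) : ∃ t, c ≤ m.real (Set.Iic t) ∧ m.real (Set.Iio t) ≤ c := by
  set S : Set ℝ := {t | c ≤ cdf m t} with hS
  have hne : S.Nonempty :=
    (((tendsto_cdf_atTop m).eventually (lt_mem_nhds h1)).exists).imp fun t ht => le_of_lt ht
  obtain ⟨b, hb⟩ := ((tendsto_cdf_atBot m).eventually (gt_mem_nhds h0)).exists
  have hbdd : BddBelow S := ⟨b, fun t ht => by
    by_contra hlt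
    exact absurd (ht.trans (monotone_cdf m (not_le.1 hlt).le)) (not_le.2 hb)⟩
  -- At the first point where the cdf reaches `c`, right continuity gives the lower bound and the
  -- left limit gives the upper one.
  refine ⟨sInf S, ?_, ?_⟩
  · rw [← cdf_eq_real]
    have hr : Tendsto (cdf m) (𝓝[>] sInf S) (𝓝 (cdf m (sInf S))) :=
      ((cdf m).right_continuous (sInf S)).mono_left (nhdsWithin_mono _ Set.Ioi_subset_Ici_self)
    refine ge_of_tendsto hr ?_
    filter_upwards [self_mem_nhdsWithin] with x hx
    obtain ⟨y, hy, hyx⟩ := (csInf_lt_iff hbdd hne).1 hx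
    exact le_trans hy (monotone_cdf m hyx.le)
  · have h2 : m (Set.Iio (sInf S)) ≤ ENNReal.ofReal c := by
      rw [← measure_cdf m, StieltjesFunction.measure_Iio _ (tendsto_cdf_atBot m), sub_zero]
      refine ENNReal.ofReal_le_ofReal ?_
      refine le_of_tendsto ((monotone_cdf m).tendsto_leftLim _) ?_
      filter_upwards [self_mem_nhdsWithin] with x hx
      by_contra hlt
      exact absurd (csInf_le hbdd (not_le.1 hlt).le) (not_le.2 hx)
    exact ENNReal.toReal_le_of_le_ofReal h0.le h2

/-- A family of sets on the line with prescribed masses and mutual gaps `δ`, for a probability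
measure which gives mass at most `w` to each interval of length `δ`. -/
theorem exists_separated_family (m : Measure ℝ) [IsProbabilityMeasure m] {N : ℕ}
    {κ : Fin (N + 1) → ℝ} (hκ : ∀ i, 0 < κ i) {δ w : ℝ} (hw : 0 ≤ w)
    (hsum : ∑ i, κ i + N * w < 1) (hm : ∀ t, m.real (Set.Icc t (t + δ)) ≤ w) :
    ∃ A : Fin (N + 1) → Set ℝ, (∀ i, MeasurableSet (A i) ∧ κ i ≤ m.real (A i)) ∧
      ∀ i k, i < k → ∀ x ∈ A i, ∀ y ∈ A k, x + δ ≤ y := by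
  set p : ℕ → ℝ := fun n => if h : n < N + 1 then κ ⟨n, h⟩ else 0 with hp
  have hp0 : ∀ n, 0 ≤ p n := fun n => by
    simp only [hp]; split_ifs with h
    exacts [(hκ _).le, le_rfl]
  have hpi : ∀ i : Fin (N + 1), p i = κ i := fun i => by
    simp only [hp, i.2, dif_pos]
  have hpsum : ∑ n ∈ Finset.range (N + 1), p n = ∑ i, κ i := by
    rw [Finset.sum_range]; exact Finset.sum_congr rfl fun i _ => hpi i
  -- Quantile levels: each step reserves `w` for the discarded gap in addition to the mass of the
  -- next piece.
  set c : ℕ → ℝ := fun n => ∑ k ∈ Finset.range (n + 1), p k + n * w with hc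
  have hcs : ∀ n, c (n + 1) = c n + w + p (n + 1) := fun n => by
    simp only [hc, Finset.sum_range_succ _ (n + 1)]; push_cast; ring
  have hcm : Monotone c := monotone_nat_of_le_succ fun n => by
    rw [hcs]; linarith [hp0 (n + 1)]
  have hc0 : 0 < c 0 := by simpa [hc, hp] using hκ 0
  have hcN : c N < 1 := by simpa [hc, hpsum] using hsum
  have hq : ∀ n : Fin (N + 1), ∃ t, c n ≤ m.real (Set.Iic t) ∧ m.real (Set.Iio t) ≤ c n :=
    fun n => exists_quantile m (hc0.trans_le (hcm (Nat.zero_le _)))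
      ((hcm (Nat.lt_succ_iff.1 n.2)).trans_lt hcN)
  choose t ht1 ht2 using hq
  have hmono : ∀ i k : Fin (N + 1), i < k → t i ≤ t k := fun i k hik => by
    by_contra hlt
    have h1 : m.real (Set.Iic (t k)) ≤ m.real (Set.Iio (t i)) :=
      measureReal_mono fun x hx => lt_of_le_of_lt hx (not_le.1 hlt)
    have h2 : c (i + 1) ≤ c k := hcm hik
    have h3 : 0 < p (i + 1) := by
      have : (i : ℕ) + 1 < N + 1 := lt_of_le_of_lt hik k.2
      simp only [hp, this, dif_pos]; exact hκ _
    linarith [ht1 k, ht2 i, hcs i]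
  refine ⟨fun i => {x | x ≤ t i ∧ ∀ k < i, t k + δ ≤ x}, fun i => ⟨?_, ?_⟩, ?_⟩
  · refine measurableSet_Iic.inter (s₂ := {x | ∀ k < i, t k + δ ≤ x}) ?_
    have : {x | ∀ k < i, t k + δ ≤ x} = ⋂ k, ⋂ (_ : k < i), Set.Ici (t k + δ) := by
      ext x; simp
    rw [this]
    exact MeasurableSet.iInter fun k => MeasurableSet.iInter fun _ => measurableSet_Ici
  · rcases Fin.eq_zero_or_eq_succ i with rfl | ⟨j, rfl⟩
    · have h := ht1 0
      have h2 : c (0 : Fin (N + 1)) = κ 0 := by simp [hc, hp]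
      rw [h2] at h
      refine h.trans (measureReal_mono fun x hx => ⟨hx, fun k hk => absurd hk (by simp)⟩)
    -- As the quantiles increase, only the preceding one matters. What is lost has mass at most `c j
    -- + w`, which leaves at least `κ j.succ`.
    · have hcov : Set.Iic (t j.succ) ⊆ {x | x ≤ t j.succ ∧ ∀ k < j.succ, t k + δ ≤ x} ∪
          (Set.Iio (t j.castSucc) ∪ Set.Icc (t j.castSucc) (t j.castSucc + δ)) := by
        intro x hx
        by_cases h : t j.castSucc + δ ≤ x
        · refine Or.inl ⟨hx, fun k hk => ?_⟩
          rcases (Fin.le_castSucc_iff.2 hk).eq_or_lt with rfl | hlt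
          · exact h
          · linarith [hmono _ _ hlt]
        · rcases lt_or_ge x (t j.castSucc) with h' | h'
          · exact Or.inr (Or.inl h')
          · exact Or.inr (Or.inr ⟨h', (not_le.1 h).le⟩)
      have h1 := (measureReal_mono hcov (μ := m)).trans (measureReal_union_le _ _)
      have h2 := measureReal_union_le (μ := m) (Set.Iio (t j.castSucc))
        (Set.Icc (t j.castSucc) (t j.castSucc + δ))
      have h3 := hcs j
      have h4 := ht1 j.succ
      have h5 := ht2 j.castSucc
      have h6 := hpi j.succ
      simp only [Fin.val_succ, Fin.val_castSucc] at h4 h5 h6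
      linarith [hm (t j.castSucc)]
  · intro i k hik x hx y hy
    linarith [hx.1, hy.2 i hik]

/-- An anti-concentrated `1`-Lipschitz function bounds the separation distance from below. -/
theorem MMSpace.ofReal_le_sep (X : MMSpace.{u}) {N : ℕ} {κ : Fin (N + 1) → ℝ} (hκ : ∀ i, 0 < κ i)
    {δ w : ℝ} (hw : 0 ≤ w) (hsum : ∑ i, κ i + N * w < 1) (F : X.carrier → ℝ)
    (hF : LipschitzWith 1 F) (hm : ∀ t, X.measure (F ⁻¹' Set.Icc t (t + δ)) ≤ ENNReal.ofReal w) :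
    ENNReal.ofReal δ ≤ X.sep κ := by
  have hFm : Measurable F := hF.continuous.measurable
  have := Measure.isProbabilityMeasure_map (μ := X.measure) hFm.aemeasurable
  obtain ⟨A, hA, hsep⟩ := exists_separated_family (X.measure.map F) hκ (δ := δ) hw hsum
    fun t => by
      rw [map_measureReal_apply hFm measurableSet_Icc]
      exact ENNReal.toReal_le_of_le_ofReal hw (hm t)
  refine le_iSup₂_of_le (fun i => F ⁻¹' A i) (fun i => ⟨hFm (hA i).1, ?_⟩) ?_
  · have h := (hA i).2
    rw [map_measureReal_apply hFm (hA i).1] at h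
    exact ENNReal.ofReal_le_of_le_toReal h
  · have key : ∀ i k, i < k → ∀ x ∈ F ⁻¹' A i, ∀ y ∈ F ⁻¹' A k,
        ENNReal.ofReal δ ≤ edist x y := fun i k hik x hx y hy => by
      rw [edist_dist]
      refine ENNReal.ofReal_le_ofReal ?_
      have h1 := hF.dist_le_mul x y
      have h2 := hsep i k hik _ hx _ hy
      rw [Real.dist_eq, NNReal.coe_one, one_mul] at h1
      linarith [neg_abs_le (F x - F y)]
    refine le_iInf fun i => le_iInf fun k => le_iInf fun hik => ?_
    refine le_iInf₂ fun x hx => le_iInf₂ fun y hy => ?_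
    rcases lt_or_gt_of_ne hik with h | h
    · exact key i k h x hx y hy
    · rw [edist_comm]; exact key k i h y hy x hx

/-! ### Volume estimates in the unit ball -/

/-- Volumes of consecutive unit balls: `V_m ≤ √m V_{m+1}`. -/
theorem volume_unitBall_le {m : ℕ} (hm : 1 ≤ m) :
    volume (Metric.closedBall (0 : EuclideanSpace ℝ (Fin m)) 1) ≤
      ENNReal.ofReal √m * volume (Metric.closedBall (0 : EuclideanSpace ℝ (Fin (m + 1))) 1) := by
  have : Nonempty (Fin m) := ⟨⟨0, hm⟩⟩
  rw [EuclideanSpace.volume_closedBall, EuclideanSpace.volume_closedBall]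
  simp only [Fintype.card_fin, ENNReal.ofReal_one, one_pow, one_mul]
  rw [← ENNReal.ofReal_mul (Real.sqrt_nonneg _)]
  refine ENNReal.ofReal_le_ofReal ?_
  have hm' : (1 : ℝ) ≤ m := by exact_mod_cast hm
  set s : ℝ := m / 2 + 1 with hs
  have hs0 : 0 < s := by positivity
  have hG : 0 < Real.Gamma s := Real.Gamma_pos_of_pos hs0
  have hG' : 0 < Real.Gamma (s + 1 / 2) := Real.Gamma_pos_of_pos (by positivity)
  -- Log-convexity of Gamma at the midpoint of `s` and `s + 1`.
  have hlog : Real.Gamma (s + 1 / 2) ≤ √s * Real.Gamma s := by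
    have h := Real.Gamma_mul_add_mul_le_rpow_Gamma_mul_rpow_Gamma hs0
      (show 0 < s + 1 by positivity) (show (0 : ℝ) < 1 / 2 by norm_num)
      (show (0 : ℝ) < 1 / 2 by norm_num) (by norm_num)
    rw [← Real.sqrt_eq_rpow, ← Real.sqrt_eq_rpow, Real.Gamma_add_one hs0.ne',
      Real.sqrt_mul hs0.le, mul_left_comm, Real.mul_self_sqrt hG.le] at h
    convert h using 2
    ring
  have hsqrt : √s ≤ √m * √Real.pi := by
    rw [← Real.sqrt_mul (by positivity)]
    refine Real.sqrt_le_sqrt ?_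
    nlinarith [Real.pi_gt_three]
  have hs2 : (((m + 1 : ℕ) : ℝ) / 2 + 1) = s + 1 / 2 := by push_cast [hs]; ring
  rw [hs2, ← mul_div_assoc, div_le_div_iff₀ hG hG', pow_succ]
  have hp : 0 < √Real.pi ^ m := by positivity
  calc √Real.pi ^ m * Real.Gamma (s + 1 / 2) ≤ √Real.pi ^ m * (√m * √Real.pi * Real.Gamma s) := by
        gcongr
        exact hlog.trans (by gcongr)
    _ = _ := by ring

/-- Splitting off the `i`-th coordinate. -/
noncomputable def splitCoord {m : ℕ} (i : Fin (m + 1)) (x : EuclideanSpace ℝ (Fin (m + 1))) :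
    ℝ × EuclideanSpace ℝ (Fin m) :=
  (x i, WithLp.toLp 2 fun k => x (i.succAbove k))

theorem measurePreserving_splitCoord {m : ℕ} (i : Fin (m + 1)) :
    MeasurePreserving (splitCoord i) volume (volume.prod volume) := by
  have h1 := PiLp.volume_preserving_ofLp (Fin (m + 1))
  have h2 := (volume_preserving_piFinSuccAbove (fun _ : Fin (m + 1) => ℝ) i).comp h1
  exact ((MeasurePreserving.id (volume : Measure ℝ)).prod
    (PiLp.volume_preserving_toLp (Fin m))).comp h2

theorem norm_sq_eq_splitCoord {m : ℕ} (i : Fin (m + 1)) (x : EuclideanSpace ℝ (Fin (m + 1))) :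
    ‖x‖ ^ 2 = (splitCoord i x).1 ^ 2 + ‖(splitCoord i x).2‖ ^ 2 := by
  rw [EuclideanSpace.real_norm_sq_eq, EuclideanSpace.real_norm_sq_eq, Fin.sum_univ_succAbove _ i]
  rfl

theorem norm_splitCoord_snd_le {m : ℕ} (i : Fin (m + 1)) (x : EuclideanSpace ℝ (Fin (m + 1))) :
    ‖(splitCoord i x).2‖ ≤ ‖x‖ :=
  le_of_sq_le_sq (by rw [norm_sq_eq_splitCoord i x]; nlinarith [sq_nonneg (splitCoord i x).1])
    (norm_nonneg _)

theorem volume_le_of_splitCoord {m : ℕ} (i : Fin (m + 1))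
    {S : Set (EuclideanSpace ℝ (Fin (m + 1)))} {T : Set (ℝ × EuclideanSpace ℝ (Fin m))}
    (hT : MeasurableSet T) (h : ∀ x ∈ S, splitCoord i x ∈ T) :
    volume S ≤ (volume.prod volume : Measure (ℝ × EuclideanSpace ℝ (Fin m))) T := by
  rw [← (measurePreserving_splitCoord i).measure_preimage hT.nullMeasurableSet]
  exact measure_mono h

/-- Slabs of the unit ball. -/
theorem volume_slab_le {m : ℕ} (hm : 1 ≤ m) (i : Fin (m + 1)) (s l : ℝ) :
    volume {x : EuclideanSpace ℝ (Fin (m + 1)) | ‖x‖ ≤ 1 ∧ x i ∈ Set.Icc s (s + l)} ≤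
      ENNReal.ofReal (l * √m) *
        volume (Metric.closedBall (0 : EuclideanSpace ℝ (Fin (m + 1))) 1) := by
  refine (volume_le_of_splitCoord i
    (measurableSet_Icc.prod (Metric.isClosed_closedBall (x := (0 : EuclideanSpace ℝ (Fin m)))
      (ε := 1)).measurableSet) fun x hx =>
      ⟨hx.2, mem_closedBall_zero_iff.2 ((norm_splitCoord_snd_le i x).trans hx.1)⟩).trans ?_
  rw [Measure.prod_prod, Real.volume_Icc, add_sub_cancel_left,
    ENNReal.ofReal_mul' (Real.sqrt_nonneg _), mul_assoc]
  gcongr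
  exact volume_unitBall_le hm

/-- The intersection of the unit ball with a thin cylinder around the origin. -/
theorem volume_box_le {m : ℕ} (hm : 1 ≤ m) (i : Fin (m + 1)) {w ρ : ℝ} (hw : 0 ≤ w) (hρ : 0 ≤ ρ)
    (hρ1 : ρ ≤ 1) :
    volume {x : EuclideanSpace ℝ (Fin (m + 1)) | |x i| ≤ w ∧ ‖(splitCoord i x).2‖ ≤ ρ} ≤
      ENNReal.ofReal (2 * w * √m * ρ) *
        volume (Metric.closedBall (0 : EuclideanSpace ℝ (Fin (m + 1))) 1) := by
  have : Nonempty (Fin m) := ⟨⟨0, hm⟩⟩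
  refine (volume_le_of_splitCoord i
    ((measurableSet_Icc (a := -w) (b := w)).prod
      (Metric.isClosed_closedBall (x := (0 : EuclideanSpace ℝ (Fin m)))
        (ε := ρ)).measurableSet) fun x hx =>
      ⟨abs_le.1 hx.1, mem_closedBall_zero_iff.2 hx.2⟩).trans ?_
  -- One factor `ρ` is enough, and it keeps the bound uniform in `m`.
  have hρm : ENNReal.ofReal ρ ^ m ≤ ENNReal.ofReal ρ := by
    refine pow_le_of_le_one zero_le ?_ (by omega)
    simpa using hρ1
  rw [Measure.prod_prod, Real.volume_Icc, Measure.addHaar_closedBall' _ _ hρ,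
    finrank_euclideanSpace, Fintype.card_fin, ENNReal.ofReal_pow hρ]
  calc ENNReal.ofReal (w - -w) * (ENNReal.ofReal ρ ^ m *
        volume (Metric.closedBall (0 : EuclideanSpace ℝ (Fin m)) 1))
      ≤ ENNReal.ofReal (w - -w) * (ENNReal.ofReal ρ * (ENNReal.ofReal √m *
        volume (Metric.closedBall (0 : EuclideanSpace ℝ (Fin (m + 1))) 1))) := by
        gcongr
        exact volume_unitBall_le hm
    _ = _ := by
        rw [ENNReal.ofReal_mul (by positivity), ENNReal.ofReal_mul (by positivity)]
        rw [show w - -w = 2 * w by ring]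
        ring

/-- Second moment estimate for a coordinate on the unit ball. -/
theorem volume_far_le {m : ℕ} (i : Fin (m + 1)) {c : ℝ} (hc : 0 < c) :
    volume {x : EuclideanSpace ℝ (Fin (m + 1)) | ‖x‖ ≤ 1 ∧ c ≤ x i ^ 2} ≤
      ENNReal.ofReal (1 / ((m + 1) * c)) *
        volume (Metric.closedBall (0 : EuclideanSpace ℝ (Fin (m + 1))) 1) := by
  set B := Metric.closedBall (0 : EuclideanSpace ℝ (Fin (m + 1))) 1
  set S : Fin (m + 1) → Set (EuclideanSpace ℝ (Fin (m + 1))) :=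
    fun k => {x | ‖x‖ ≤ 1 ∧ c ≤ x k ^ 2}
  have hSm : ∀ k, MeasurableSet (S k) := fun k =>
    ((isClosed_le continuous_norm continuous_const).inter
      (isClosed_le (g := fun x : EuclideanSpace ℝ (Fin (m + 1)) => x k ^ 2) continuous_const
        (by fun_prop))).measurableSet
  -- Swapping coordinates is an isometry, so all `S k` have the same volume. Chebyshev applied to
  -- the sum over `k` then gains the factor `m + 1`, since the squared coordinates sum to at most 1.
  have hsymm : ∀ k, volume (S k) = volume (S i) := fun k => by
    set f := LinearIsometryEquiv.piLpCongrLeft 2 ℝ ℝ (Equiv.swap i k)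
    rw [← f.measurePreserving.measure_preimage (hSm k).nullMeasurableSet]
    congr 1
    ext x
    have h1 : f x k = x i := by
      simp [f, LinearIsometryEquiv.piLpCongrLeft_apply, Equiv.piCongrLeft']
    simp only [S, Set.mem_preimage, Set.mem_ofPred_eq, h1, LinearIsometryEquiv.norm_map]
  have h1 : ∑ k, volume (S k) = ∫⁻ x in B, ∑ k, (S k).indicator 1 x := by
    rw [lintegral_finsetSum _ fun k _ => measurable_one.indicator (hSm k)]
    refine Finset.sum_congr rfl fun k _ => ?_
    rw [lintegral_indicator_one (hSm k), Measure.restrict_apply (hSm k), Set.inter_eq_left.2]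
    exact fun x hx => mem_closedBall_zero_iff.2 hx.1
  have h2 : ∫⁻ x in B, ∑ k, (S k).indicator 1 x ≤ ∫⁻ _ in B, ENNReal.ofReal (1 / c) := by
    refine setLIntegral_mono measurable_const fun x hx => ?_
    have hx1 : ‖x‖ ≤ 1 := mem_closedBall_zero_iff.1 hx
    have hterm : ∀ k, (S k).indicator (1 : EuclideanSpace ℝ (Fin (m + 1)) → ℝ≥0∞) x ≤ ENNReal.ofReal (x k ^ 2 / c) :=
      fun k => by
        by_cases hk : x ∈ S k
        · rw [Set.indicator_of_mem hk, Pi.one_apply, ← ENNReal.ofReal_one]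
          exact ENNReal.ofReal_le_ofReal ((one_le_div hc).2 hk.2)
        · rw [Set.indicator_of_notMem hk]; exact zero_le
    refine (Finset.sum_le_sum fun k _ => hterm k).trans ?_
    rw [← ENNReal.ofReal_sum_of_nonneg fun k _ => by positivity]
    refine ENNReal.ofReal_le_ofReal ?_
    rw [← Finset.sum_div, ← EuclideanSpace.real_norm_sq_eq]
    gcongr
    exact pow_le_one₀ (norm_nonneg _) hx1
  rw [setLIntegral_const, ← h1, Finset.sum_congr rfl fun k _ => hsymm k, Finset.sum_const,
    Finset.card_univ, Fintype.card_fin, nsmul_eq_mul] at h2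
  rw [one_div, mul_inv, ENNReal.ofReal_mul (by positivity), ENNReal.ofReal_inv_of_pos
    (by positivity), mul_assoc, ← one_div c]
  have hcast : ENNReal.ofReal ((m : ℝ) + 1) = ((m + 1 : ℕ) : ℝ≥0∞) := by
    rw [← ENNReal.ofReal_natCast]; push_cast; rfl
  rw [hcast]
  exact (ENNReal.mul_le_iff_le_inv (by simp) (by simp)).1 h2

/-! ### Anti-concentration on the sphere, by cones -/

/-- The inverse of `u ↦ u / √(u² + r²)` is Lipschitz on bounded sets. -/
theorem sub_le_of_div_sqrt_sub_le {u u' r M l : ℝ} (hr : 0 < r) (hM : 0 ≤ M) (hu : |u| ≤ M * r)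
    (hu' : |u'| ≤ M * r) (hle : u ≤ u') (h : u' / √(u' ^ 2 + r ^ 2) - u / √(u ^ 2 + r ^ 2) ≤ l) :
    u' - u ≤ 2 * (1 + M) ^ 3 * r * l := by
  set R := √(u ^ 2 + r ^ 2) with hR
  set R' := √(u' ^ 2 + r ^ 2) with hR'
  have hR0 : 0 < R := Real.sqrt_pos.2 (by positivity)
  have hR0' : 0 < R' := Real.sqrt_pos.2 (by positivity)
  have hRs : R ^ 2 = u ^ 2 + r ^ 2 := Real.sq_sqrt (by positivity)
  have hRs' : R' ^ 2 = u' ^ 2 + r ^ 2 := Real.sq_sqrt (by positivity)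
  have hb : ∀ v : ℝ, |v| ≤ M * r → √(v ^ 2 + r ^ 2) ≤ (1 + M) * r := fun v hv => by
    refine Real.sqrt_le_iff.2 ⟨by positivity, ?_⟩
    nlinarith [sq_abs v, abs_nonneg v, mul_nonneg hM (mul_self_nonneg r),
      mul_le_mul hv hv (abs_nonneg v) (by positivity)]
  have hRb := hb u hu
  have hRb' := hb u' hu'
  have habs : u * u' ≤ R * R' := by
    have h1 : |u| ≤ R := Real.abs_le_sqrt (by nlinarith)
    have h2 : |u'| ≤ R' := Real.abs_le_sqrt (by nlinarith)
    calc u * u' ≤ |u * u'| := le_abs_self _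
      _ = |u| * |u'| := abs_mul _ _
      _ ≤ R * R' := by gcongr
  -- Rationalizing the difference; the last factor is at least `r ^ 2` because `u * u' ≤ R * R'`.
  have hid : (u' / R' - u / R) * ((R + R') * (R * R')) = (u' - u) * (r ^ 2 + R * R' - u * u') := by
    have : (u' / R' - u / R) * ((R + R') * (R * R')) = (u' * R - u * R') * (R + R') := by
      field_simp
    rw [this]
    linear_combination u' * hRs - u * hRs'
  have h1 : (u' - u) * r ^ 2 ≤ (u' / R' - u / R) * ((R + R') * (R * R')) := by
    rw [hid]; nlinarith
  have hl : 0 ≤ l := by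
    refine le_trans ?_ h
    by_contra hneg
    have : (u' / R' - u / R) * ((R + R') * (R * R')) < 0 :=
      mul_neg_of_neg_of_pos (not_le.1 hneg) (by positivity)
    nlinarith [mul_nonneg (sub_nonneg.2 hle) (sq_nonneg r)]
  have h2 : (R + R') * (R * R') ≤ ((1 + M) * r + (1 + M) * r) * (((1 + M) * r) * ((1 + M) * r)) := by
    gcongr
  have h3 : (u' - u) * r ^ 2 ≤ l * (((1 + M) * r + (1 + M) * r) * (((1 + M) * r) * ((1 + M) * r))) :=
    h1.trans (mul_le_mul h h2 (by positivity) hl)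
  have h4 : (u' - u) * r ^ 2 ≤ (2 * (1 + M) ^ 3 * r * l) * r ^ 2 := by
    refine h3.trans (le_of_eq ?_); ring
  exact le_of_mul_le_mul_right h4 (by positivity)

/-- Length is at most diameter, which the Lipschitz inverse controls; for `r = 0` only `u = 0`
remains. -/
theorem volume_near_slice_le {r M s l : ℝ} (hr : 0 ≤ r) (hM : 0 ≤ M) :
    volume {u : ℝ | |u| ≤ M * r ∧ u / √(u ^ 2 + r ^ 2) ∈ Set.Icc s (s + l)} ≤
      ENNReal.ofReal (2 * (1 + M) ^ 3 * r * l) := by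
  refine (Real.volume_le_diam _).trans (Metric.ediam_le fun u hu u' hu' => ?_)
  rw [edist_dist]
  refine ENNReal.ofReal_le_ofReal ?_
  rcases hr.eq_or_lt with rfl | hr
  · have h1 : u = 0 := by simpa using hu.1
    have h2 : u' = 0 := by simpa using hu'.1
    simp [h1, h2]
  rw [Real.dist_eq, abs_le]
  rcases le_total u u' with h | h
  · have := sub_le_of_div_sqrt_sub_le (l := l) hr hM hu.1 hu'.1 h (by linarith [hu.2.1, hu'.2.2])
    constructor <;> linarith
  · have := sub_le_of_div_sqrt_sub_le (l := l) hr hM hu'.1 hu.1 h (by linarith [hu'.2.1, hu.2.2])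
    constructor <;> linarith

/-- A spherical band away from the poles, as a cone in the unit ball. -/
theorem volume_near_le {m : ℕ} (hm : 1 ≤ m) (i : Fin (m + 1)) {M : ℝ} (hM : 0 ≤ M) (s : ℝ) {l : ℝ}
    (hl : 0 ≤ l) :
    volume {x : EuclideanSpace ℝ (Fin (m + 1)) | ‖x‖ ≤ 1 ∧ |x i| ≤ M * ‖(splitCoord i x).2‖ ∧
        x i / ‖x‖ ∈ Set.Icc s (s + l)} ≤
      ENNReal.ofReal (2 * (1 + M) ^ 3 * l * √m) *
        volume (Metric.closedBall (0 : EuclideanSpace ℝ (Fin (m + 1))) 1) := by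
  set T : Set (ℝ × EuclideanSpace ℝ (Fin m)) := {p | ‖p.2‖ ≤ 1 ∧ |p.1| ≤ M * ‖p.2‖ ∧
    p.1 / √(p.1 ^ 2 + ‖p.2‖ ^ 2) ∈ Set.Icc s (s + l)} with hTdef
  have hT : MeasurableSet T := by
    refine (measurableSet_le (f := fun p : ℝ × EuclideanSpace ℝ (Fin m) => ‖p.2‖)
      (by fun_prop) measurable_const).inter
      ((measurableSet_le (f := fun p : ℝ × EuclideanSpace ℝ (Fin m) => |p.1|)
        (g := fun p => M * ‖p.2‖) (by fun_prop) (by fun_prop)).inter ?_)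
    exact measurableSet_preimage (f := fun p : ℝ × EuclideanSpace ℝ (Fin m) =>
      p.1 / √(p.1 ^ 2 + ‖p.2‖ ^ 2)) (by fun_prop) measurableSet_Icc
  refine (volume_le_of_splitCoord i hT fun x hx =>
    ⟨(norm_splitCoord_snd_le i x).trans hx.1, hx.2.1, ?_⟩).trans ?_
  · rw [← norm_sq_eq_splitCoord, Real.sqrt_sq (norm_nonneg _)]
    exact hx.2.2
  rw [Measure.prod_apply_symm hT]
  calc ∫⁻ v : EuclideanSpace ℝ (Fin m), volume ((fun u : ℝ => (u, v)) ⁻¹' T)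
      ≤ ∫⁻ v, (Metric.closedBall (0 : EuclideanSpace ℝ (Fin m)) 1).indicator
          (fun _ => ENNReal.ofReal (2 * (1 + M) ^ 3 * l)) v := by
        refine lintegral_mono fun v => ?_
        by_cases hv : ‖v‖ ≤ 1
        · rw [Set.indicator_of_mem (mem_closedBall_zero_iff.2 hv)]
          refine (measure_mono fun u hu => hu.2).trans
            ((volume_near_slice_le (norm_nonneg v) hM).trans (ENNReal.ofReal_le_ofReal ?_))
          have : 0 ≤ 2 * (1 + M) ^ 3 * l := by positivity
          nlinarith
        · have : (fun u : ℝ => (u, v)) ⁻¹' T = ∅ :=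
            Set.eq_empty_of_forall_notMem fun u hu => hv hu.1
          simp [this]
    _ = ENNReal.ofReal (2 * (1 + M) ^ 3 * l) *
          volume (Metric.closedBall (0 : EuclideanSpace ℝ (Fin m)) 1) := by
        rw [lintegral_indicator_const Metric.isClosed_closedBall.measurableSet]
    _ ≤ _ := by
        rw [ENNReal.ofReal_mul' (Real.sqrt_nonneg _), mul_assoc (ENNReal.ofReal _)]
        exact mul_le_mul_right (volume_unitBall_le hm) _

/-- Anti-concentration of a coordinate on the unit sphere, uniformly in the dimension: spherical
bands as cones in the unit ball. -/
theorem volume_band_le {m : ℕ} (hm : 1 ≤ m) (i : Fin (m + 1)) {L : ℝ} (hL : 1 ≤ L) (s : ℝ) {h : ℝ}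
    (hh : 0 ≤ h) :
    volume {x : EuclideanSpace ℝ (Fin (m + 1)) | ‖x‖ ≤ 1 ∧ x i / ‖x‖ ∈ Set.Icc s (s + h / √m)} ≤
      ENNReal.ofReal (3 / L ^ 2 + 2 * (1 + L ^ 4) ^ 3 * h) *
        volume (Metric.closedBall (0 : EuclideanSpace ℝ (Fin (m + 1))) 1) := by
  have hm' : (1 : ℝ) ≤ m := by exact_mod_cast hm
  have hL0 : 0 < L := by linarith
  have hq : 1 ≤ √(m : ℝ) := Real.one_le_sqrt.2 hm'
  have hq2 : √(m : ℝ) ^ 2 = m := Real.sq_sqrt (by positivity)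
  have hcov : {x : EuclideanSpace ℝ (Fin (m + 1)) | ‖x‖ ≤ 1 ∧
      x i / ‖x‖ ∈ Set.Icc s (s + h / √m)} ⊆
      ({x | ‖x‖ ≤ 1 ∧ L ^ 2 / m ≤ x i ^ 2} ∪
        {x | |x i| ≤ L / √m ∧ ‖(splitCoord i x).2‖ ≤ 1 / L ^ 3}) ∪
      {x | ‖x‖ ≤ 1 ∧ |x i| ≤ L ^ 4 * ‖(splitCoord i x).2‖ ∧
        x i / ‖x‖ ∈ Set.Icc s (s + h / √m)} := by
    intro x hx
    by_cases h1 : L ^ 2 / m ≤ x i ^ 2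
    · exact Or.inl (Or.inl ⟨hx.1, h1⟩)
    by_cases h2 : |x i| ≤ L ^ 4 * ‖(splitCoord i x).2‖
    · exact Or.inr ⟨hx.1, h2, hx.2⟩
    have h3 : |x i| ≤ L / √m := by
      refine abs_le_of_sq_le_sq ?_ (by positivity)
      rw [div_pow, hq2]; exact (not_le.1 h1).le
    -- Failing the cone condition, L⁴ ‖v‖ < |x_i| ≤ L / √m ≤ L, hence ‖v‖ ≤ 1 / L³.
    refine Or.inl (Or.inr ⟨h3, ?_⟩)
    have h4 : L / √m ≤ L := div_le_self hL0.le hq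
    have h5 : L ^ 4 * ‖(splitCoord i x).2‖ ≤ L := ((not_le.1 h2).le.trans h3).trans h4
    rw [le_div_iff₀ (by positivity)]
    refine le_of_mul_le_mul_left ?_ hL0
    linarith
  have h1 := volume_far_le i (c := L ^ 2 / m) (by positivity)
  have h2 := volume_box_le hm i (w := L / √m) (ρ := 1 / L ^ 3) (by positivity) (by positivity)
    ((div_le_one (by positivity)).2 (one_le_pow₀ hL))
  have h3 := volume_near_le hm i (M := L ^ 4) (by positivity) s (l := h / √m) (by positivity)
  refine (measure_mono hcov).trans ((measure_union_le _ _).trans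
    ((add_le_add_left (measure_union_le _ _) _).trans
      ((add_le_add (add_le_add h1 h2) h3).trans ?_)))
  rw [← add_mul, ← add_mul, ← ENNReal.ofReal_add (by positivity) (by positivity),
    ← ENNReal.ofReal_add (by positivity) (by positivity)]
  refine mul_le_mul_left (ENNReal.ofReal_le_ofReal ?_) _
  have e1 : 1 / ((m + 1) * (L ^ 2 / m)) ≤ 1 / L ^ 2 := by
    refine one_div_le_one_div_of_le (by positivity) ?_
    rw [← mul_div_assoc, le_div_iff₀ (by positivity)]
    nlinarith [sq_nonneg L]
  have e2 : 2 * (L / √m) * √m * (1 / L ^ 3) = 2 / L ^ 2 := by field_simp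
  have e3 : 2 * (1 + L ^ 4) ^ 3 * (h / √m) * √m = 2 * (1 + L ^ 4) ^ 3 * h := by field_simp
  rw [e2, e3]
  have : 3 / L ^ 2 = 1 / L ^ 2 + 2 / L ^ 2 := by ring
  linarith

theorem unitSphereMeasure_band_le {m : ℕ} (hm : 1 ≤ m) (i : Fin (m + 1)) {L : ℝ} (hL : 1 ≤ L)
    (s : ℝ) {h : ℝ} (hh : 0 ≤ h) :
    unitSphereMeasure (m + 1) {y | y.1 i ∈ Set.Icc s (s + h / √m)} ≤
      ENNReal.ofReal (3 / L ^ 2 + 2 * (1 + L ^ 4) ^ 3 * h) := by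
  have hS : MeasurableSet {y : Metric.sphere (0 : EuclideanSpace ℝ (Fin (m + 1))) 1 |
      y.1 i ∈ Set.Icc s (s + h / √m)} :=
    (isClosed_Icc.preimage (f := fun y : Metric.sphere (0 : EuclideanSpace ℝ (Fin (m + 1))) 1 =>
      y.1 i) (by fun_prop)).measurableSet
  have hcone : volume (Set.Ioo (0 : ℝ) 1 • (Subtype.val ''
      {y : Metric.sphere (0 : EuclideanSpace ℝ (Fin (m + 1))) 1 |
        y.1 i ∈ Set.Icc s (s + h / √m)})) ≤ _ :=
    (measure_mono ?_).trans (volume_band_le hm i hL s hh)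
  · set V := volume (Metric.closedBall (0 : EuclideanSpace ℝ (Fin (m + 1))) 1) with hV
    have hV0 : V ≠ 0 := (Metric.measure_closedBall_pos _ _ one_pos).ne'
    have hVt : V ≠ ∞ := measure_closedBall_lt_top.ne
    rw [unitSphereMeasure, Measure.smul_apply, Measure.toSphere_apply_univ,
      Measure.toSphere_apply' _ hS, finrank_euclideanSpace, Fintype.card_fin, smul_eq_mul,
      ← Measure.addHaar_closedBall_eq_addHaar_ball, ← hV]
    -- `toSphere` is the dimension times the volume of the cone; that factor cancels in the
    -- normalization.
    rw [mul_comm _⁻¹, ← div_eq_mul_inv, ENNReal.mul_div_mul_left _ _ (by simp) (by simp)]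
    exact ENNReal.div_le_of_le_mul hcone
  · rintro _ ⟨r, hr, _, ⟨y, hy, rfl⟩, rfl⟩
    have hy1 : ‖(y : EuclideanSpace ℝ (Fin (m + 1)))‖ = 1 := by simp
    have hn : ‖r • (y : EuclideanSpace ℝ (Fin (m + 1)))‖ = r := by
      rw [norm_smul, hy1, mul_one, Real.norm_eq_abs, abs_of_pos hr.1]
    refine ⟨hn.trans_le hr.2.le, ?_⟩
    simp only [hn, PiLp.smul_apply, smul_eq_mul]
    rw [mul_div_cancel_left₀ _ hr.1.ne']
    exact hy

/-! ### Slabs of ellipsoids, and the conclusion -/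

theorem ellipsoidMeasure_slab_le {m : ℕ} (hm : 1 ≤ m) {α : Fin (m + 1) → ℝ} (hα : ∀ i, 0 < α i)
    (i : Fin (m + 1)) {L : ℝ} (hL : 1 ≤ L) (t : ℝ) {δ h : ℝ} (hδ : 0 ≤ δ)
    (hδh : δ * √m ≤ h * α i) :
    ellipsoidMeasure hα {x | x.1 i ∈ Set.Icc t (t + δ)} ≤
      ENNReal.ofReal (3 / L ^ 2 + 2 * (1 + L ^ 4) ^ 3 * h) := by
  have hq : 0 < √(m : ℝ) := Real.sqrt_pos.2 (by exact_mod_cast hm)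
  have hh : 0 ≤ h := by
    have h1 : 0 ≤ h * α i := (by positivity : 0 ≤ δ * √(m : ℝ)).trans hδh
    exact nonneg_of_mul_nonneg_left h1 (hα i)
  have hm1 : Measurable fun x : Metric.sphere (0 : EuclideanSpace ℝ (Fin (m + 1))) 1 =>
      (⟨axisScale α x.1, axisScale_mem_ellipsoidSet hα x.2⟩ : ellipsoidSet α) :=
    (((continuous_axisScale α).comp continuous_subtype_val).subtype_mk _).measurable
  have hS : MeasurableSet {x : ellipsoidSet α | x.1 i ∈ Set.Icc t (t + δ)} :=
    (isClosed_Icc.preimage (f := fun x : ellipsoidSet α => x.1 i) (by fun_prop)).measurableSet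
  rw [ellipsoidMeasure, Measure.map_apply hm1 hS]
  refine (measure_mono ?_).trans (unitSphereMeasure_band_le hm i hL (t / α i) hh)
  intro y hy
  have hy' : α i * y.1 i ∈ Set.Icc t (t + δ) := hy
  have hi := hα i
  constructor
  · rw [div_le_iff₀ hi]; linarith [hy'.1]
  · have h1 : y.1 i ≤ (t + δ) / α i := by rw [le_div_iff₀ hi]; linarith [hy'.2]
    refine h1.trans ?_
    rw [add_div]
    gcongr 1
    rwa [div_le_div_iff₀ hi hq]

/-- `axisScale` as a linear map. -/
noncomputable def axisScaleLin {n : ℕ} (α : Fin n → ℝ) :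
    EuclideanSpace ℝ (Fin n) →ₗ[ℝ] EuclideanSpace ℝ (Fin n) where
  toFun := axisScale α
  map_add' x y := by ext i; simp [axisScale, mul_add]
  map_smul' c x := by ext i; simp [axisScale, mul_left_comm]

theorem axisScaleLin_apply {n : ℕ} (α : Fin n → ℝ) (x : EuclideanSpace ℝ (Fin n)) (i : Fin n) :
    axisScaleLin α x i = α i * x i := rfl

theorem solidEllipsoidSet_inter_eq_image {n : ℕ} {α : Fin n → ℝ} (hα : ∀ i, 0 < α i)
    (P : EuclideanSpace ℝ (Fin n) → Prop) :
    solidEllipsoidSet α ∩ {x | P x} =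
      axisScaleLin α '' {x | ‖x‖ ≤ 1 ∧ P (axisScaleLin α x)} := by
  have hform : ∀ x, axisScaleLin α x ∈ solidEllipsoidSet α ↔ ‖x‖ ≤ 1 := fun x => by
    rw [← sq_le_one_iff₀ (norm_nonneg _), EuclideanSpace.real_norm_sq_eq]
    change ∑ i, (α i * x i) ^ 2 / α i ^ 2 ≤ 1 ↔ _
    rw [Finset.sum_congr rfl fun i _ => ?_]
    have := (hα i).ne'
    field_simp
  ext x
  constructor
  · rintro ⟨hx, hP⟩
    have hxe : axisScaleLin α (WithLp.toLp 2 fun i => x i / α i) = x := by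
      ext i
      rw [axisScaleLin_apply]
      exact mul_div_cancel₀ _ (hα i).ne'
    refine ⟨_, ⟨(hform _).1 (hxe.symm ▸ hx), ?_⟩, hxe⟩
    rw [hxe]; exact hP
  · rintro ⟨y, ⟨hy, hP⟩, rfl⟩
    exact ⟨(hform y).2 hy, hP⟩

theorem solidEllipsoidMeasure_slab_le {m : ℕ} (hm : 1 ≤ m) {α : Fin (m + 1) → ℝ}
    (hα : ∀ i, 0 < α i) (i : Fin (m + 1)) (t : ℝ) {δ h : ℝ} (hδh : δ * √m ≤ h * α i) :
    solidEllipsoidMeasure α {x | x.1 i ∈ Set.Icc t (t + δ)} ≤ ENNReal.ofReal h := by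
  have hi := hα i
  have hball := solidEllipsoidSet_inter_eq_image hα fun _ => True
  have hslab := solidEllipsoidSet_inter_eq_image hα fun x => x i ∈ Set.Icc t (t + δ)
  rw [show {x : EuclideanSpace ℝ (Fin (m + 1)) | True} = Set.univ from rfl,
    Set.inter_univ] at hball
  have himg : Subtype.val '' {x : solidEllipsoidSet α | x.1 i ∈ Set.Icc t (t + δ)} =
      solidEllipsoidSet α ∩ {x | x i ∈ Set.Icc t (t + δ)} :=
    Subtype.image_preimage_coe (solidEllipsoidSet α) {x | x i ∈ Set.Icc t (t + δ)}
  rw [solidEllipsoidMeasure, Measure.smul_apply, smul_eq_mul,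
    comap_subtype_coe_apply (isClosed_solidEllipsoidSet α).measurableSet, himg,
    mul_comm, ← div_eq_mul_inv]
  refine ENNReal.div_le_of_le_mul ?_
  -- Slab and ellipsoid are images under the same linear map, so its determinant cancels.
  rw [hslab, hball, Measure.addHaar_image_linearMap, Measure.addHaar_image_linearMap,
    mul_left_comm]
  refine mul_le_mul_right ?_ _
  have hq : 0 < √(m : ℝ) := Real.sqrt_pos.2 (by exact_mod_cast hm)
  have hb : {x : EuclideanSpace ℝ (Fin (m + 1)) | ‖x‖ ≤ 1 ∧ True} = Metric.closedBall 0 1 := by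
    ext x; simp
  rw [hb]
  refine (measure_mono (t := {x : EuclideanSpace ℝ (Fin (m + 1)) | ‖x‖ ≤ 1 ∧
    x i ∈ Set.Icc (t / α i) (t / α i + δ / α i)}) fun x hx => ⟨hx.1, ?_⟩).trans
    ((volume_slab_le hm i (t / α i) (δ / α i)).trans ?_)
  · have hx2 := hx.2
    rw [axisScaleLin_apply] at hx2
    rw [← add_div]
    exact ⟨by rw [div_le_iff₀ hi]; linarith [hx2.1], by rw [le_div_iff₀ hi]; linarith [hx2.2]⟩
  · refine mul_le_mul_left (ENNReal.ofReal_le_ofReal ?_) _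
    rwa [div_mul_eq_mul_div, div_le_iff₀ hi]

theorem ofReal_le_sep_ellipsoid (kind : EllipsoidKind) {n : ℕ} (hn : 2 ≤ n) {α : Fin n → ℝ}
    (hα : ∀ i, 0 < α i) (i : Fin n) {N : ℕ} {κ : Fin (N + 1) → ℝ} (hκ : ∀ i, 0 < κ i)
    {L δ h w : ℝ} (hL : 1 ≤ L) (hδ : 0 ≤ δ) (hδh : δ * √((n : ℝ) - 1) ≤ h * α i)
    (hw : 3 / L ^ 2 + 2 * (1 + L ^ 4) ^ 3 * h ≤ w) (hsum : ∑ i, κ i + N * w < 1) :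
    ENNReal.ofReal δ ≤ (ellipsoid kind hn hα).sep κ := by
  obtain ⟨m, rfl⟩ : ∃ m, n = m + 1 := ⟨n - 1, by omega⟩
  have hm : 1 ≤ m := by omega
  rw [show ((m + 1 : ℕ) : ℝ) - 1 = m by push_cast; ring] at hδh
  have hh : 0 ≤ h := by
    have h1 : 0 ≤ h * α i := (by positivity : 0 ≤ δ * √(m : ℝ)).trans hδh
    exact nonneg_of_mul_nonneg_left h1 (hα i)
  have hL0 : 0 < L := by linarith
  have hlip : ∀ S : Set (EuclideanSpace ℝ (Fin (m + 1))), LipschitzWith 1 fun x : S => x.1 i :=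
    fun S => LipschitzWith.of_dist_le_mul fun x y => by
      rw [NNReal.coe_one, one_mul, Subtype.dist_eq, dist_eq_norm, dist_eq_norm]
      exact PiLp.norm_apply_le (x.1 - y.1) i
  have hw0 : 0 ≤ w := le_trans (by positivity) hw
  cases kind with
  | solid =>
    refine MMSpace.ofReal_le_sep _ hκ hw0 hsum (fun x : solidEllipsoidSet α => x.1 i) (hlip _)
      fun t => (solidEllipsoidMeasure_slab_le hm hα i t hδh).trans (ENNReal.ofReal_le_ofReal ?_)
    -- The bound `h` for the solid case is weaker than needed by this factor, so one `w` serves both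
    -- kinds.
    have h1 : 1 ≤ (1 + L ^ 4) ^ 3 := one_le_pow₀ (by nlinarith [pow_pos hL0 4])
    have h2 : 0 ≤ 3 / L ^ 2 := by positivity
    nlinarith
  | surface =>
    exact MMSpace.ofReal_le_sep _ hκ hw0 hsum (fun x : ellipsoidSet α => x.1 i) (hlip _)
      fun t => (ellipsoidMeasure_slab_le hm hα i hL t hδ hδh).trans (ENNReal.ofReal_le_ofReal hw)

theorem proposition3p3 (kind : ℕ → EllipsoidKind) (n : ℕ → ℕ) (hn : ∀ j, 2 ≤ n j)
    (a : (j : ℕ) → Fin (n j) → ℝ) (ha : ∀ j i, 0 < a j i)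
    (hsup : Tendsto (fun j => ⨆ i, a j i) atTop atTop) :
    MMSpace.InfinitelyDissipates fun j =>
      ellipsoid (kind j) (hn j) (α := fun i => √((n j : ℝ) - 1) * a j i)
        (sqrt_mul_pos (hn j) (ha j)) := by
  intro δ hδ N hN κ hκ hsum
  have hN0 : (0 : ℝ) < N := by exact_mod_cast hN
  -- The `N` gaps together use half of the spare mass.
  set w : ℝ := (1 - ∑ i, κ i) / (2 * N) with hw
  have hw0 : 0 < w := div_pos (by linarith) (by positivity)
  have hsum' : ∑ i, κ i + N * w < 1 := by
    have : N * w = (1 - ∑ i, κ i) / 2 := by rw [hw]; field_simp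
    linarith
  obtain ⟨L, hL, hLw⟩ : ∃ L : ℝ, 1 ≤ L ∧ 3 / L ^ 2 ≤ w / 2 := by
    have h1 : Tendsto (fun L : ℝ => 3 / L ^ 2) atTop (𝓝 0) :=
      tendsto_const_nhds.div_atTop (tendsto_pow_atTop two_ne_zero)
    exact ((eventually_ge_atTop 1).and (h1.eventually_le_const (half_pos hw0))).exists
  have hK : 0 < 2 * (1 + L ^ 4) ^ 3 := by positivity
  set h : ℝ := w / 2 / (2 * (1 + L ^ 4) ^ 3) with hh
  have hh0 : 0 < h := by positivity
  have hLh : 3 / L ^ 2 + 2 * (1 + L ^ 4) ^ 3 * h ≤ w := by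
    have : 2 * (1 + L ^ 4) ^ 3 * h = w / 2 := mul_div_cancel₀ _ hK.ne'
    linarith
  refine le_liminf_of_le (by isBoundedDefault) ?_
  filter_upwards [hsup.eventually_ge_atTop (δ / h)] with j hj
  have : Nonempty (Fin (n j)) := ⟨⟨0, by linarith [hn j]⟩⟩
  obtain ⟨i, hi⟩ := exists_eq_ciSup_of_finite (f := a j)
  rw [← hi, div_le_iff₀ hh0] at hj
  refine ofReal_le_sep_ellipsoid (kind j) (hn j) (sqrt_mul_pos (hn j) (ha j)) i hκ hL hδ.le ?_ hLh
    hsum'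
  -- The factor √(n - 1) appears on both sides, so `δ ≤ a j i * h` suffices.
  have := Real.sqrt_nonneg ((n j : ℝ) - 1)
  nlinarith
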